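/- Let $\mathfrak{su}(3)$ be the real Lie algebra of traceless skew-Hermitian complex $3\times 3$ matrices. A $D$-dimensional representation of $\mathfrak{su}(3)$ is a homomorphism of real Lie algebras $\mathfrak{su}(3)\to\operatorname{End}_{\mathbb C}(V)$ with $V$ a complex vector space of dimension $D$; representations are counted up to equivalence (isomorphism). For $d\in\mathbb N$ let $\xi(d)$ be the number of equivalence classes of $d$-dimensional irreducible representations of $\mathfrak{su}(3)$, and let $R_3=\{d\in\mathbb N:\xi(d)\neq 0\}$. A representation on $V$ is said to preserve an $N$-dimensional vector (to have an $N$-dimensional noiseless subsystem) if $V$ is the direct sum of exactly $N$ irreducible subrepresentations; that is, if $V$ decomposes into irreducible subrepresentations, $n_i$ of them of dimension $d_i$ for distinct dimensions $d_1,\dots,d_r$, so that $\dim V=\sum_i n_i d_i$, with $N=\sum_i n_i$. **Theorem.** For all $D,N\in\mathbb N$, the number of $D$-dimensional representations of $\mathfrak{su}(3)$ which preserve an $N$-dimensional vector is $$ \sum_{\mathfrak p}\ \prod_{i=1}^{n}\binom{n_i+\xi(p_i)-1}{n_i}, $$ where the sum is over all partitions $\mathfrak p$ of $D$, written $D=\sum_{i=1}^{n}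 n_i p_i$ with the parts $p_i$ distinct and multiplicities $n_i\ge 1$, such that every $p_i\in R_3$ and $\sum_{i=1}^{n} n_i=N$. In particular this number, like every $\xi(d)$, is finite. -/

import Mathlib

attribute [local instance 100] LieRing.ofAssociativeRing

/-- The real Lie algebra `su(3)` of traceless skew-Hermitian complex `3 × 3` matrices. -/
def su3 : LieSubalgebra ℝ (Matrix (Fin 3) (Fin 3) ℂ) where
  carrier := {A | A.conjTranspose = -A ∧ A.trace = 0}
  zero_mem' := by simp
  add_mem' := by
    rintro A B ⟨hA, hA'⟩ ⟨hB, hB'⟩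
    refine ⟨?_, by simp [hA', hB']⟩
    rw [Matrix.conjTranspose_add, hA, hB]
    abel
  smul_mem' := by
    rintro c A ⟨hA, hA'⟩
    refine ⟨?_, by simp [hA']⟩
    rw [Matrix.conjTranspose_smul, hA]
    simp
  lie_mem' := by
    rintro A B ⟨hA, _⟩ ⟨hB, _⟩
    refine ⟨?_, by rw [Ring.lie_def, Matrix.trace_sub, Matrix.trace_mul_comm, sub_self]⟩
    rw [Ring.lie_def, Matrix.conjTranspose_sub, Matrix.conjTranspose_mul,
      Matrix.conjTranspose_mul, hA, hB]
    simp

/-- A `D`-dimensional complex representation of `su(3)`, realised on `ℂ^D`. -/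
abbrev SU3Rep (D : ℕ) : Type :=
  su3 →ₗ⁅ℝ⁆ Module.End ℂ (Fin D → ℂ)

namespace SU3Rep

/-- Equivalence of representations: an invertible complex-linear intertwiner exists. -/
def Equivalent {D : ℕ} (ρ σ : SU3Rep D) : Prop :=
  ∃ g : (Fin D → ℂ) ≃ₗ[ℂ] (Fin D → ℂ), ∀ (x : su3) (v : Fin D → ℂ), g (ρ x v) = σ x (g v)

instance setoid (D : ℕ) : Setoid (SU3Rep D) where
  r := Equivalent
  iseqv :=
    { refl := fun _ => ⟨LinearEquiv.refl ℂ _, fun _ _ => rfl⟩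
      symm := by
        rintro ρ σ ⟨g, hg⟩
        refine ⟨g.symm, fun x v => ?_⟩
        rw [LinearEquiv.symm_apply_eq, hg, LinearEquiv.apply_symm_apply]
      trans := by
        rintro ρ σ τ ⟨g, hg⟩ ⟨h, hh⟩
        refine ⟨g.trans h, fun x v => ?_⟩
        rw [LinearEquiv.trans_apply, LinearEquiv.trans_apply, hg, hh] }

/-- `W` is a subrepresentation of `ρ`. -/
def IsInvariant {D : ℕ} (ρ : SU3Rep D) (W : Submodule ℂ (Fin D → ℂ)) : Prop :=
  ∀ x : su3, ∀ w ∈ W, ρ x w ∈ W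

/-- `W` is an irreducible subrepresentation of `ρ`: it is invariant and nonzero, and its only
invariant subspaces are `0` and `W`. -/
def IsIrreducibleSub {D : ℕ} (ρ : SU3Rep D) (W : Submodule ℂ (Fin D → ℂ)) : Prop :=
  IsInvariant ρ W ∧ W ≠ ⊥ ∧
    ∀ U : Submodule ℂ (Fin D → ℂ), IsInvariant ρ U → U ≤ W → U = ⊥ ∨ U = W

/-- `ρ` is an irreducible representation. -/
def IsIrreducible {D : ℕ} (ρ : SU3Rep D) : Prop :=
  IsIrreducibleSub ρ ⊤

/-- `ρ` preserves an `N`-dimensional vector (has an `N`-dimensional noiseless subsystem):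
the space is the direct sum of `N` irreducible subrepresentations. Equivalently, if the
summands are grouped by dimension into `n_i` summands of dimension `d_i`, then `N = ∑ n_i`. -/
def PreservesVector {D : ℕ} (ρ : SU3Rep D) (N : ℕ) : Prop :=
  ∃ W : Fin N → Submodule ℂ (Fin D → ℂ),
    DirectSum.IsInternal W ∧ ∀ i, IsIrreducibleSub ρ (W i)

end SU3Rep

/-- Equivalence classes of `d`-dimensional irreducible representations of `su(3)`. -/
def irrepClasses (d : ℕ) : Set (Quotient (SU3Rep.setoid d)) :=
  {c | ∃ ρ : SU3Rep d, ρ.IsIrreducible ∧ Quotient.mk _ ρ = c}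

/-- `ξ(d)`: the number of `d`-dimensional irreducible representations, up to equivalence. -/
noncomputable def xi (d : ℕ) : ℕ := (irrepClasses d).ncard

/-- `R₃`: the set of dimensions of irreducible representations of `su(3)`. -/
def R3 : Set ℕ := {d | xi d ≠ 0}

/-- Equivalence classes of `D`-dimensional representations of `su(3)` that preserve an
`N`-dimensional vector. -/
def preservingClasses (D N : ℕ) : Set (Quotient (SU3Rep.setoid D)) :=
  {c | ∃ ρ : SU3Rep D, ρ.PreservesVector N ∧ Quotient.mk _ ρ = c}

open Classical in
/-- The partitions of `D` with all parts in `R₃` and exactly `N` parts, counted with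
multiplicity. -/
noncomputable def partitionsR3 (D N : ℕ) : Finset (Nat.Partition D) :=
  Finset.univ.filter fun P => (∀ p ∈ P.parts, p ∈ R3) ∧ P.parts.card = N

/-! The count rests on a bijection: a class of representations that are sums of `N` irreducibles is
the same as a multiset of `N` irreducible classes whose dimensions add up to `D`. The decomposition
is part of the hypothesis, so complete reducibility is not needed, only uniqueness of
multiplicities. That follows from Schur's lemma (`finrank_intertwiners_of_isIrred`): the
multiplicity of a class is the dimension of the space of intertwiners from it
(`finrank_intertwiners_multisetAction`).

Mapping each class to its dimension sends such a multiset to a partition of `D`. The fibre over a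
partition is obtained by choosing, for each distinct part `p` of multiplicity `n`, a multiset of `n`
of the `xi p` classes; stars and bars gives the binomial coefficient (`card_multiset_map_fst`).

The counting needs every `xi d` to be a genuine cardinality, since `ncard` of an infinite set is
`0`. Finiteness comes from highest weight theory. The representation is extended to complex
matrices; an irreducible one has a highest weight vector, it is determined up to isomorphism by the
weight `(a, b)`, and `sl₂` theory makes `a` and `b` natural numbers below `d`
(`irrepClasses_finite`).

Actions are handled as bare functions on an arbitrary space `V`, because summands, products and
cyclic subspaces do not live on `Fin D → ℂ`. -/

/-- The map `r` is a complex-linear representation of the real Lie algebra `su(3)` on `V`. -/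
structure IsRep {V : Type*} [AddCommGroup V] [Module ℂ V] (r : su3 → Module.End ℂ V) : Prop where
  protected map_add : ∀ x y, r (x + y) = r x + r y
  protected map_smul : ∀ (c : ℝ) x, r (c • x) = (c : ℂ) • r x
  protected map_lie : ∀ x y, r ⁅x, y⁆ = r x * r y - r y * r x

/-! ### Extending a representation of `su(3)` to complex matrices -/

/-- The projection of complex matrices onto `su(3)`, real-linear, which kills the scalar and the
traceless Hermitian matrices. -/
noncomputable def skewPart (X : Matrix (Fin 3) (Fin 3) ℂ) : su3 :=
  ⟨(1 / 2 : ℂ) • (X - X.conjTranspose) -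
    ((1 / 6 : ℂ) * (X.trace - star X.trace)) • (1 : Matrix (Fin 3) (Fin 3) ℂ), by
    constructor
    · simp only [Matrix.conjTranspose_sub, Matrix.conjTranspose_smul,
        Matrix.conjTranspose_conjTranspose, Matrix.conjTranspose_one]
      ext i j
      simp
      ring
    · simp
      ring⟩

theorem skewPart_add (X Y : Matrix (Fin 3) (Fin 3) ℂ) :
    skewPart (X + Y) = skewPart X + skewPart Y := by
  apply Subtype.ext
  ext i j
  simp [skewPart]
  ring

theorem skewPart_smul (c : ℝ) (X : Matrix (Fin 3) (Fin 3) ℂ) :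
    skewPart ((c : ℂ) • X) = c • skewPart X := by
  apply Subtype.ext
  ext i j
  simp [skewPart]
  ring

theorem skewPart_coe (x : su3) : skewPart (x : Matrix (Fin 3) (Fin 3) ℂ) = x := by
  apply Subtype.ext
  have h1 : (x : Matrix (Fin 3) (Fin 3) ℂ).conjTranspose = -x := x.2.1
  have h2 : (x : Matrix (Fin 3) (Fin 3) ℂ).trace = 0 := x.2.2
  simp only [skewPart, h1, h2]
  ext i j
  simp
  ring

theorem skewPart_I_smul_coe (x : su3) :
    skewPart (Complex.I • (x : Matrix (Fin 3) (Fin 3) ℂ)) = 0 := by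
  apply Subtype.ext
  have h1 : (x : Matrix (Fin 3) (Fin 3) ℂ).conjTranspose = -x := x.2.1
  have h2 : (x : Matrix (Fin 3) (Fin 3) ℂ).trace = 0 := x.2.2
  simp only [skewPart, Matrix.conjTranspose_smul, Matrix.trace_smul, h1, h2]
  ext i j
  simp

theorem skewPart_smul_one (c : ℂ) :
    skewPart (c • (1 : Matrix (Fin 3) (Fin 3) ℂ)) = 0 := by
  apply Subtype.ext
  simp only [skewPart, Matrix.conjTranspose_smul, Matrix.trace_smul]
  ext i j
  simp
  ring

/-- Every matrix is skew-Hermitian plus `i` times skew-Hermitian, and removing the trace from both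
leaves a scalar: `gl₃(ℂ) = su(3) ⊕ i su(3) ⊕ ℂ`. -/
theorem eq_skewPart (X : Matrix (Fin 3) (Fin 3) ℂ) :
    X = (skewPart X : Matrix (Fin 3) (Fin 3) ℂ) +
      Complex.I • (skewPart (-Complex.I • X) : Matrix (Fin 3) (Fin 3) ℂ) +
      (X.trace / 3) • (1 : Matrix (Fin 3) (Fin 3) ℂ) := by
  ext i j
  simp only [skewPart, Matrix.conjTranspose_smul, Matrix.trace_smul]
  simp
  -- The sides differ only through `I ^ 2`, which arises when the outer `I` meets the `I` in
  -- `skewPart (-I • X)`; the factor is its coefficient.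
  linear_combination (1 / 2 * X i j + 1 / 2 * (starRingEnd ℂ) (X j i)
    - 1 / 6 * (X.trace + (starRingEnd ℂ) X.trace) * (1 : Matrix (Fin 3) (Fin 3) ℂ) i j)
      * Complex.I_sq

section Complexification

variable {V : Type*} [AddCommGroup V] [Module ℂ V] {r : su3 → Module.End ℂ V}

/-- The complex-linear extension of a representation of `su(3)` to all matrices. -/
noncomputable def complexify (r : su3 → Module.End ℂ V) (X : Matrix (Fin 3) (Fin 3) ℂ) :
    Module.End ℂ V :=
  r (skewPart X) + Complex.I • r (skewPart (-Complex.I • X))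

namespace IsRep

protected theorem map_zero (hr : IsRep r) : r 0 = 0 := by
  simpa using hr.map_smul 0 0

protected theorem map_neg (hr : IsRep r) (x : su3) : r (-x) = -r x := by
  simpa using hr.map_smul (-1) x

protected theorem map_sub (hr : IsRep r) (x y : su3) : r (x - y) = r x - r y := by
  rw [sub_eq_add_neg, hr.map_add, hr.map_neg, sub_eq_add_neg]

theorem complexify_add (hr : IsRep r) (X Y : Matrix (Fin 3) (Fin 3) ℂ) :
    complexify r (X + Y) = complexify r X + complexify r Y := by
  simp only [complexify, smul_add, skewPart_add, hr.map_add]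
  abel

theorem complexify_coe (hr : IsRep r) (x : su3) :
    complexify r (x : Matrix (Fin 3) (Fin 3) ℂ) = r x := by
  have h : skewPart (-Complex.I • (x : Matrix (Fin 3) (Fin 3) ℂ)) = 0 := by
    have := skewPart_I_smul_coe (-x)
    simpa using this
  rw [complexify, skewPart_coe, h, hr.map_zero]
  simp

theorem complexify_smul_I (hr : IsRep r) (X : Matrix (Fin 3) (Fin 3) ℂ) :
    complexify r (Complex.I • X) = Complex.I • complexify r X := by
  have h1 : -Complex.I • Complex.I • X = X := by
    rw [smul_smul]; simp
  have h2 : skewPart (Complex.I • X) = -skewPart (-Complex.I • X) := by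
    have := skewPart_smul (-1) (-Complex.I • X)
    simpa using this
  rw [complexify, h1, h2, hr.map_neg, complexify, smul_add, smul_smul, Complex.I_mul_I]
  simp only [neg_smul, one_smul]
  abel

theorem complexify_smul (hr : IsRep r) (c : ℂ) (X : Matrix (Fin 3) (Fin 3) ℂ) :
    complexify r (c • X) = c • complexify r X := by
  have hreal (a : ℝ) (Y : Matrix (Fin 3) (Fin 3) ℂ) :
      complexify r ((a : ℂ) • Y) = (a : ℂ) • complexify r Y := by
    rw [complexify, smul_comm, skewPart_smul, skewPart_smul, hr.map_smul, hr.map_smul, complexify,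
      smul_add, smul_comm Complex.I]
  have hc : c = (c.re : ℂ) + (c.im : ℂ) * Complex.I := (Complex.re_add_im c).symm
  rw [hc, add_smul, mul_smul, hr.complexify_add, hreal, hreal, hr.complexify_smul_I, add_smul,
    mul_smul]

theorem complexify_smul_one (hr : IsRep r) (c : ℂ) :
    complexify r (c • (1 : Matrix (Fin 3) (Fin 3) ℂ)) = 0 := by
  rw [complexify, smul_smul, skewPart_smul_one, skewPart_smul_one, hr.map_zero]
  simp

/-- Scalar parts are central, so they cancel in the commutator and may act by zero; the rest is
bilinear expansion of brackets in `su(3)`. -/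
theorem complexify_mul_sub_mul (hr : IsRep r) (X Y : Matrix (Fin 3) (Fin 3) ℂ) :
    complexify r (X * Y - Y * X) =
      complexify r X * complexify r Y - complexify r Y * complexify r X := by
  set A := skewPart X with hA
  set B := skewPart (-Complex.I • X) with hB
  set C := skewPart Y with hC
  set E := skewPart (-Complex.I • Y) with hE
  have hXY : X * Y - Y * X = ((⁅A, C⁆ - ⁅B, E⁆ : su3) : Matrix (Fin 3) (Fin 3) ℂ) +
      Complex.I • ((⁅A, E⁆ + ⁅B, C⁆ : su3) : Matrix (Fin 3) (Fin 3) ℂ) := by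
    have h1 : ((⁅A, C⁆ - ⁅B, E⁆ : su3) : Matrix (Fin 3) (Fin 3) ℂ) =
      (A * C - C * A) - (B * E - E * B) := rfl
    have h2 : ((⁅A, E⁆ + ⁅B, C⁆ : su3) : Matrix (Fin 3) (Fin 3) ℂ) =
      (A * E - E * A) + (B * C - C * B) := rfl
    rw [h1, h2, eq_skewPart X, eq_skewPart Y, ← hA, ← hB, ← hC, ← hE]
    simp only [mul_add, add_mul, smul_mul_assoc, mul_smul_comm, one_mul, mul_one, smul_add,
      smul_sub, smul_smul, Complex.I_mul_I]
    rw [mul_comm (X.trace / 3) (Y.trace / 3), mul_comm (X.trace / 3) Complex.I,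
      mul_comm (Y.trace / 3) Complex.I]
    module
  rw [hXY, hr.complexify_add, hr.complexify_smul_I, hr.complexify_coe, hr.complexify_coe,
    hr.map_sub, hr.map_add, hr.map_lie, hr.map_lie, hr.map_lie, hr.map_lie]
  simp only [complexify, ← hA, ← hB, ← hC, ← hE]
  simp only [mul_add, add_mul, smul_mul_assoc, mul_smul_comm, smul_add, smul_sub, smul_smul,
    Complex.I_mul_I]
  module

end IsRep

end Complexification

/-! ### Highest weight vectors -/

section HighestWeight

variable {V : Type*} [AddCommGroup V] [Module ℂ V] {r : su3 → Module.End ℂ V}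

/-- The action of the matrix unit `(i, j)` in the complexified representation. -/
noncomputable def unitAction (r : su3 → Module.End ℂ V) (i j : Fin 3) : Module.End ℂ V :=
  complexify r (Matrix.single i j 1)

theorem IsRep.unitAction_comm (hr : IsRep r) (i j k l : Fin 3) :
    unitAction r i j * unitAction r k l - unitAction r k l * unitAction r i j =
      (if j = k then unitAction r i l else 0) - (if l = i then unitAction r k j else 0) := by
  have h0 : complexify r 0 = 0 := by simpa using hr.complexify_smul 0 0
  have hneg (X) : complexify r (-X) = -complexify r X := by
    simpa using hr.complexify_smul (-1) X
  have hs (X Y) : complexify r (X - Y) = complexify r X - complexify r Y := by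
    rw [sub_eq_add_neg, hr.complexify_add, hneg, sub_eq_add_neg]
  rw [unitAction, unitAction, ← hr.complexify_mul_sub_mul, hs]
  congr 1
  · by_cases h : j = k
    · subst h; simp [unitAction]
    · simp [h, h0]
  · by_cases h : l = i
    · subst h; simp [unitAction]
    · simp [h, h0]

/-- The commutation relation as a rewriting rule on vectors; with explicit indices `simp` decides
the Kronecker deltas. -/
theorem IsRep.unitAction_apply (hr : IsRep r) (i j k l : Fin 3) (v : V) :
    unitAction r i j (unitAction r k l v) = unitAction r k l (unitAction r i j v) +
      ((if j = k then unitAction r i l v else 0) - (if l = i then unitAction r k j v else 0)) := by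
  have := congrArg (fun f : Module.End ℂ V => f v) (hr.unitAction_comm i j k l)
  simp only [LinearMap.sub_apply, Module.End.mul_apply] at this
  rw [← sub_eq_iff_eq_add', this]
  congr 1 <;> split_ifs <;> rfl

/-- A subspace stable under the simple root operators is stable under `su(3)`. -/
theorem IsRep.mem_of_unitAction_mem (hr : IsRep r) {U : Submodule ℂ V}
    (h01 : ∀ u ∈ U, unitAction r 0 1 u ∈ U) (h12 : ∀ u ∈ U, unitAction r 1 2 u ∈ U)
    (h10 : ∀ u ∈ U, unitAction r 1 0 u ∈ U) (h21 : ∀ u ∈ U, unitAction r 2 1 u ∈ U)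
    (x : su3) (u : V) (hu : u ∈ U) : r x u ∈ U := by
  -- Stability under two operators gives stability under their commutator; the simple root operators
  -- thus yield the remaining root operators and the differences of diagonal units.
  have key (i j k l : Fin 3) (hij : ∀ u ∈ U, unitAction r i j u ∈ U)
      (hkl : ∀ u ∈ U, unitAction r k l u ∈ U) (u : V) (hu : u ∈ U) :
      ((if j = k then unitAction r i l u else 0) -
        (if l = i then unitAction r k j u else 0)) ∈ U := by
    have := hr.unitAction_apply i j k l u
    rw [← sub_eq_iff_eq_add'] at this
    rw [← this]
    exact U.sub_mem (hij _ (hkl _ hu)) (hkl _ (hij _ hu))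
  have h02 : unitAction r 0 2 u ∈ U := by simpa using key 0 1 1 2 h01 h12 u hu
  have h20 : unitAction r 2 0 u ∈ U := by simpa using key 2 1 1 0 h21 h10 u hu
  have hh1 : unitAction r 0 0 u - unitAction r 1 1 u ∈ U := by simpa using key 0 1 1 0 h01 h10 u hu
  have hh2 : unitAction r 1 1 u - unitAction r 2 2 u ∈ U := by simpa using key 1 2 2 1 h12 h21 u hu
  have hone : unitAction r 0 0 u + unitAction r 1 1 u + unitAction r 2 2 u = 0 := by
    have : complexify r (Matrix.single 0 0 1 + Matrix.single 1 1 1 + Matrix.single 2 2 1) = 0 := by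
      rw [show (Matrix.single 0 0 1 + Matrix.single 1 1 1 + Matrix.single 2 2 1 :
        Matrix (Fin 3) (Fin 3) ℂ) = (1 : ℂ) • 1 by
          ext i j; fin_cases i <;> fin_cases j <;> simp [Matrix.single]]
      exact hr.complexify_smul_one 1
    rw [hr.complexify_add, hr.complexify_add] at this
    exact congrArg (fun f : Module.End ℂ V => f u) this
  have hdiag (i : Fin 3) : unitAction r i i u ∈ U := by
    -- The identity matrix acts by zero, so each diagonal unit acts as its traceless part: `E₀₀ -
    -- 1/3 = (2/3)(E₀₀ - E₁₁) + (1/3)(E₁₁ - E₂₂)`.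
    have h0 : unitAction r 0 0 u = (2 / 3 : ℂ) • (unitAction r 0 0 u - unitAction r 1 1 u) +
        (1 / 3 : ℂ) • (unitAction r 1 1 u - unitAction r 2 2 u) := by
      have : unitAction r 2 2 u = -(unitAction r 0 0 u + unitAction r 1 1 u) :=
        (neg_eq_of_add_eq_zero_right hone).symm
      rw [this]
      module
    have m0 : unitAction r 0 0 u ∈ U := by
      rw [h0]
      exact U.add_mem (U.smul_mem _ hh1) (U.smul_mem _ hh2)
    have m1 : unitAction r 1 1 u ∈ U := by simpa using U.sub_mem m0 hh1
    have m2 : unitAction r 2 2 u ∈ U := by simpa using U.sub_mem m1 hh2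
    fin_cases i
    exacts [m0, m1, m2]
  have hall (i j : Fin 3) : unitAction r i j u ∈ U := by
    fin_cases i <;> fin_cases j
    exacts [hdiag 0, h01 u hu, h02, h10 u hu, hdiag 1, h12 u hu, h20, h21 u hu, hdiag 2]
  have hx : r x = ∑ i, ∑ j, (x : Matrix (Fin 3) (Fin 3) ℂ) i j • unitAction r i j := by
    have hsum {ι : Type} (s : Finset ι) (f : ι → Matrix (Fin 3) (Fin 3) ℂ) :
        complexify r (∑ i ∈ s, f i) = ∑ i ∈ s, complexify r (f i) :=
      _root_.map_sum (AddMonoidHom.mk' (complexify r) hr.complexify_add) f s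
    conv_lhs => rw [← hr.complexify_coe x, Matrix.matrix_eq_sum_single
      (x : Matrix (Fin 3) (Fin 3) ℂ)]
    simp only [hsum, unitAction, ← hr.complexify_smul, Matrix.smul_single, smul_eq_mul, mul_one]
  rw [hx]
  simp only [LinearMap.sum_apply, LinearMap.smul_apply]
  exact U.sum_mem fun i _ => U.sum_mem fun j _ => U.smul_mem _ (hall i j)

/-- A highest weight vector of weight `(a, b)`. -/
structure IsHighestWeightVector (r : su3 → Module.End ℂ V) (v : V) (a b : ℂ) : Prop where
  ne_zero : v ≠ 0
  raise_one : unitAction r 0 1 v = 0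
  raise_two : unitAction r 1 2 v = 0
  weight_one : unitAction r 0 0 v - unitAction r 1 1 v = a • v
  weight_two : unitAction r 1 1 v - unitAction r 2 2 v = b • v

/-- In a finite-dimensional representation of `sl₂`, the weight of a highest weight vector is a
natural number smaller than the dimension. -/
theorem exists_nat_lt_finrank_of_sl2 [FiniteDimensional ℂ V] {e f h : Module.End ℂ V}
    (hef : ∀ v, e (f v) = f (e v) + h v) (hhf : ∀ v, h (f v) = f (h v) - (2 : ℂ) • f v)
    {v : V} {μ : ℂ} (hv : v ≠ 0) (hev : e v = 0) (hhv : h v = μ • v) :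
    ∃ n : ℕ, n < Module.finrank ℂ V ∧ μ = n := by
  have hh (k : ℕ) : h ((f ^ k) v) = (μ - 2 * k) • (f ^ k) v := by
    induction k with
    | zero => simpa using hhv
    | succ k ih =>
      rw [pow_succ', Module.End.mul_apply, hhf, ih, map_smul, ← sub_smul]
      congr 1
      push_cast
      ring
  have he (k : ℕ) : e ((f ^ (k + 1)) v) = ((k + 1) * (μ - k)) • (f ^ k) v := by
    induction k with
    | zero => simp [hef, hev, hhv]
    | succ k ih =>
      rw [pow_succ', Module.End.mul_apply, hef, ih, hh, map_smul, ← Module.End.mul_apply,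
        ← pow_succ', ← add_smul]
      congr 1
      push_cast
      ring
  -- Nonzero vectors `f ^ k v` have distinct `h`-eigenvalues `μ - 2k`, so `finrank + 1` of them
  -- cannot all be nonzero.
  have hex : ∃ k, k ≤ Module.finrank ℂ V ∧ (f ^ k) v = 0 := by
    by_contra! hcon
    have hli : LinearIndependent ℂ (fun k : Fin (Module.finrank ℂ V + 1) => (f ^ (k : ℕ)) v) := by
      refine Module.End.eigenvectors_linearIndependent' h
        (fun k : Fin (Module.finrank ℂ V + 1) => μ - 2 * ((k : ℕ) : ℂ)) ?_ _ ?_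
      · intro k l hkl
        simpa [Fin.ext_iff] using hkl
      · intro k
        exact ⟨Module.End.mem_eigenspace_iff.2 (hh k), hcon k (Nat.lt_succ_iff.1 k.2)⟩
    have := hli.fintype_card_le_finrank
    simp at this
  have hex' : ∃ k, (f ^ k) v = 0 := ⟨_, hex.choose_spec.2⟩
  classical
  obtain ⟨k, hk, hmin⟩ : ∃ k, (f ^ k) v = 0 ∧ ∀ j < k, (f ^ j) v ≠ 0 :=
    ⟨Nat.find hex', Nat.find_spec hex', fun j hj => Nat.find_min hex' hj⟩
  obtain ⟨l, hl, hl0⟩ := hex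
  have hkl : k ≤ l := by
    by_contra! hlt
    exact hmin l hlt hl0
  -- At the first vanishing power `n + 1`, the formula `he` gives `(n + 1)(μ - n) f ^ n v = 0` with
  -- `f ^ n v ≠ 0`, hence `μ = n`.
  obtain _ | n := k
  · exact absurd (by simpa using hk) hv
  refine ⟨n, by omega, ?_⟩
  have := he n
  rw [hk, map_zero, eq_comm, smul_eq_zero] at this
  rcases this with h1 | h1
  · rcases mul_eq_zero.1 h1 with h2 | h2
    · exact absurd h2 (Nat.cast_add_one_ne_zero n)
    · exact sub_eq_zero.1 h2
  · exact absurd h1 (hmin n (Nat.lt_succ_self n))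

theorem IsRep.exists_nat_of_isHighestWeightVector [FiniteDimensional ℂ V] (hr : IsRep r) {v : V}
    {a b : ℂ} (hv : IsHighestWeightVector r v a b) :
    (∃ n : ℕ, n < Module.finrank ℂ V ∧ a = n) ∧ ∃ n : ℕ, n < Module.finrank ℂ V ∧ b = n := by
  constructor
  · refine exists_nat_lt_finrank_of_sl2 (e := unitAction r 0 1) (f := unitAction r 1 0)
      (h := unitAction r 0 0 - unitAction r 1 1) ?_ ?_ hv.ne_zero hv.raise_one hv.weight_one
    · intro u
      simp [hr.unitAction_apply 0 1 1 0]
    · intro u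
      simp [hr.unitAction_apply 0 0 1 0, hr.unitAction_apply 1 1 1 0]
      module
  · refine exists_nat_lt_finrank_of_sl2 (e := unitAction r 1 2) (f := unitAction r 2 1)
      (h := unitAction r 1 1 - unitAction r 2 2) ?_ ?_ hv.ne_zero hv.raise_two hv.weight_two
    · intro u
      simp [hr.unitAction_apply 1 2 2 1]
    · intro u
      simp [hr.unitAction_apply 1 1 2 1, hr.unitAction_apply 2 2 2 1]
      module

/-- Both simple raising operators increase the eigenvalue of `E₀₀ - E₂₂` by one, so they kill the
eigenspace whose eigenvalue has largest real part. `E₀₀ - E₁₁` commutes with `E₀₀ - E₂₂`, hence has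
an eigenvector there. -/
theorem IsRep.exists_isHighestWeightVector [FiniteDimensional ℂ V] [Nontrivial V]
    (hr : IsRep r) : ∃ v a b, IsHighestWeightVector r v a b := by
  set h : Module.End ℂ V := unitAction r 0 0 - unitAction r 2 2 with hh
  obtain ⟨μ, hμ, hmax⟩ : ∃ μ, h.HasEigenvalue μ ∧ ∀ ν, h.HasEigenvalue ν → ν.re ≤ μ.re := by
    obtain ⟨c, hc⟩ := Module.End.exists_eigenvalue h
    obtain ⟨μ, hμ, hmax⟩ := Set.exists_max_image {μ | h.HasEigenvalue μ} Complex.re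
      (Module.End.finite_hasEigenvalue h) ⟨c, hc⟩
    exact ⟨μ, hμ, hmax⟩
  have hraise (e : Module.End ℂ V) (he : ∀ v, h (e v) = e (h v) + e v) (v : V)
      (hv : h v = μ • v) : e v = 0 := by
    by_contra hne
    have : h.HasEigenvalue (μ + 1) :=
      Module.End.hasEigenvalue_of_hasEigenvector (x := e v)
        ⟨Module.End.mem_eigenspace_iff.2 (by rw [he, hv, map_smul, add_smul, one_smul]), hne⟩
    have := hmax _ this
    simp at this
    linarith
  have hmaps : ∀ v ∈ h.eigenspace μ,
      (unitAction r 0 0 - unitAction r 1 1 : Module.End ℂ V) v ∈ h.eigenspace μ := by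
    intro v hv
    rw [Module.End.mem_eigenspace_iff] at hv ⊢
    rw [← map_smul, ← hv, hh]
    simp [hr.unitAction_apply 0 0 1 1, hr.unitAction_apply 2 2 1 1, hr.unitAction_apply 2 2 0 0]
    abel
  have : Nontrivial (h.eigenspace μ) := by
    rw [Submodule.nontrivial_iff_ne_bot]
    exact hμ
  obtain ⟨a, ha⟩ := Module.End.exists_eigenvalue
    ((unitAction r 0 0 - unitAction r 1 1 : Module.End ℂ V).restrict hmaps)
  obtain ⟨⟨v, hvμ⟩, hv⟩ := ha.exists_hasEigenvector
  have hva : (unitAction r 0 0 - unitAction r 1 1 : Module.End ℂ V) v = a • v :=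
    congrArg Subtype.val hv.apply_eq_smul
  have hv0 : v ≠ 0 := fun h0 => hv.2 (Subtype.ext h0)
  rw [Module.End.mem_eigenspace_iff] at hvμ
  refine ⟨v, a, μ - a, hv0, hraise _ ?_ v hvμ, hraise _ ?_ v hvμ, hva, ?_⟩
  · intro u
    simp [hh, hr.unitAction_apply 0 0 0 1, hr.unitAction_apply 2 2 0 1]
    abel
  · intro u
    simp [hh, hr.unitAction_apply 0 0 1 2, hr.unitAction_apply 2 2 1 2]
    abel
  · rw [sub_smul, ← hvμ, ← hva, hh]
    simp

/-- The subrepresentation generated by a highest weight vector has a one-dimensional highest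
weight space. -/
theorem IsRep.exists_cyclic (hr : IsRep r) {m : V} {a b : ℂ} (hm : IsHighestWeightVector r m a b) :
    ∃ U : Submodule ℂ V, m ∈ U ∧ (∀ x, ∀ u ∈ U, r x u ∈ U) ∧
      ∀ u ∈ U, unitAction r 0 0 u - unitAction r 2 2 u = (a + b) • u → ∃ c : ℂ, u = c • m := by
  -- `U` is the smallest subspace containing `m` and closed under the two simple lowering operators;
  -- its minimality serves as an induction principle.
  set P : Set (Submodule ℂ V) :=
    {S | m ∈ S ∧ ∀ u ∈ S, unitAction r 1 0 u ∈ S ∧ unitAction r 2 1 u ∈ S} with hP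
  set U := sInf P with hU
  have hmin (S) (hS : S ∈ P) : U ≤ S := sInf_le hS
  have hUm : m ∈ U := by
    rw [hU, Submodule.mem_sInf]
    exact fun S hS => hS.1
  have hU1 (u) (hu : u ∈ U) : unitAction r 1 0 u ∈ U := by
    rw [hU, Submodule.mem_sInf] at hu ⊢
    exact fun S hS => (hS.2 u (hu S hS)).1
  have hU2 (u) (hu : u ∈ U) : unitAction r 2 1 u ∈ U := by
    rw [hU, Submodule.mem_sInf] at hu ⊢
    exact fun S hS => (hS.2 u (hu S hS)).2
  set h1 : Module.End ℂ V := unitAction r 0 0 - unitAction r 1 1 with hh1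
  set h2 : Module.End ℂ V := unitAction r 1 1 - unitAction r 2 2 with hh2
  have c1 (u) : h1 (unitAction r 1 0 u) =
      unitAction r 1 0 (h1 u) - (2 : ℂ) • unitAction r 1 0 u := by
    simp [hh1, hr.unitAction_apply 0 0 1 0, hr.unitAction_apply 1 1 1 0]
    module
  have c2 (u) : h1 (unitAction r 2 1 u) = unitAction r 2 1 (h1 u) + unitAction r 2 1 u := by
    simp [hh1, hr.unitAction_apply 0 0 2 1, hr.unitAction_apply 1 1 2 1]
    module
  have c3 (u) : h2 (unitAction r 1 0 u) = unitAction r 1 0 (h2 u) + unitAction r 1 0 u := by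
    simp [hh2, hr.unitAction_apply 1 1 1 0, hr.unitAction_apply 2 2 1 0]
    module
  have c4 (u) : h2 (unitAction r 2 1 u) =
      unitAction r 2 1 (h2 u) - (2 : ℂ) • unitAction r 2 1 u := by
    simp [hh2, hr.unitAction_apply 1 1 2 1, hr.unitAction_apply 2 2 2 1]
    module
  have d1 (u) : unitAction r 0 1 (unitAction r 1 0 u) =
      unitAction r 1 0 (unitAction r 0 1 u) + h1 u := by
    simp [hh1, hr.unitAction_apply 0 1 1 0]
  have d2 (u) : unitAction r 0 1 (unitAction r 2 1 u) = unitAction r 2 1 (unitAction r 0 1 u) := by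
    simp [hr.unitAction_apply 0 1 2 1]
  have d3 (u) : unitAction r 1 2 (unitAction r 1 0 u) = unitAction r 1 0 (unitAction r 1 2 u) := by
    simp [hr.unitAction_apply 1 2 1 0]
  have d4 (u) : unitAction r 1 2 (unitAction r 2 1 u) =
      unitAction r 2 1 (unitAction r 1 2 u) + h2 u := by
    simp [hh2, hr.unitAction_apply 1 2 2 1]
  -- The vectors of `U` that the Cartan and simple raising operators keep in `U` form a subspace
  -- containing `m` and closed under lowering, so they are all of `U`.
  have hstable : U ≤ U ⊓ (U.comap h1 ⊓ (U.comap h2 ⊓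
      (U.comap (unitAction r 0 1) ⊓ U.comap (unitAction r 1 2)))) := by
    apply hmin
    constructor
    · simp only [Submodule.mem_inf, Submodule.mem_comap]
      refine ⟨hUm, ?_, ?_, ?_, ?_⟩
      · rw [show h1 m = a • m from hm.weight_one]
        exact U.smul_mem _ hUm
      · rw [show h2 m = b • m from hm.weight_two]
        exact U.smul_mem _ hUm
      · rw [hm.raise_one]
        exact U.zero_mem
      · rw [hm.raise_two]
        exact U.zero_mem
    · simp only [Submodule.mem_inf, Submodule.mem_comap]
      rintro u ⟨hu, u1, u2, u3, u4⟩
      refine ⟨⟨hU1 u hu, ?_, ?_, ?_, ?_⟩, hU2 u hu, ?_, ?_, ?_, ?_⟩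
      · rw [c1]
        exact U.sub_mem (hU1 _ u1) (U.smul_mem _ (hU1 u hu))
      · rw [c3]
        exact U.add_mem (hU1 _ u2) (hU1 u hu)
      · rw [d1]
        exact U.add_mem (hU1 _ u3) u1
      · rw [d3]
        exact hU1 _ u4
      · rw [c2]
        exact U.add_mem (hU2 _ u1) (hU2 u hu)
      · rw [c4]
        exact U.sub_mem (hU2 _ u2) (U.smul_mem _ (hU2 u hu))
      · rw [d2]
        exact hU2 _ u3
      · rw [d4]
        exact U.add_mem (hU2 _ u4) u2
  refine ⟨U, hUm, ?_, ?_⟩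
  · refine hr.mem_of_unitAction_mem (fun u hu => (hstable hu).2.2.2.1)
      (fun u hu => (hstable hu).2.2.2.2) hU1 hU2
  set h : Module.End ℂ V := unitAction r 0 0 - unitAction r 2 2 with hh
  -- Lowering decreases the eigenvalue of `h` by one, so `U` lies in `span {m} ⊔ T`, with `T`
  -- gathering eigenvalues strictly below `a + b`. Independence of eigenspaces then leaves only
  -- `span {m}` at eigenvalue `a + b`.
  set T : Submodule ℂ V := ⨆ k : ℕ, h.eigenspace (a + b - (k + 1)) with hT
  have hhm : h m = (a + b) • m := by
    rw [add_smul, ← hm.weight_one, ← hm.weight_two, hh]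
    simp
  have hf1 (u) : h (unitAction r 1 0 u) = unitAction r 1 0 (h u) - unitAction r 1 0 u := by
    simp [hh, hr.unitAction_apply 0 0 1 0, hr.unitAction_apply 2 2 1 0]
    module
  have hf2 (u) : h (unitAction r 2 1 u) = unitAction r 2 1 (h u) - unitAction r 2 1 u := by
    simp [hh, hr.unitAction_apply 0 0 2 1, hr.unitAction_apply 2 2 2 1]
    module
  have hlow (f : Module.End ℂ V) (hf : ∀ u, h (f u) = f (h u) - f u) :
      ∀ u ∈ Submodule.span ℂ {m} ⊔ T, f u ∈ Submodule.span ℂ {m} ⊔ T := by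
    have hle : Submodule.span ℂ {m} ⊔ T ≤ T.comap f := by
      refine sup_le ?_ (iSup_le fun k => ?_)
      · rw [Submodule.span_singleton_le_iff_mem, Submodule.mem_comap]
        refine Submodule.mem_iSup_of_mem 0 (Module.End.mem_eigenspace_iff.2 ?_)
        rw [hf, hhm, map_smul]
        push_cast
        module
      · intro u hu
        rw [Module.End.mem_eigenspace_iff] at hu
        rw [Submodule.mem_comap]
        refine Submodule.mem_iSup_of_mem (k + 1) (Module.End.mem_eigenspace_iff.2 ?_)
        rw [hf, hu, map_smul]
        push_cast
        module
    exact fun u hu => le_sup_right (a := Submodule.span ℂ {m}) (hle hu)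
  have hUT : U ≤ Submodule.span ℂ {m} ⊔ T := by
    refine hmin _ ⟨le_sup_left (a := Submodule.span ℂ {m}) (Submodule.mem_span_singleton_self m),
      fun u hu => ⟨hlow _ hf1 u hu, hlow _ hf2 u hu⟩⟩
  intro u hu huw
  obtain ⟨y, hy, t, ht, hyt⟩ := Submodule.mem_sup.1 (hUT hu)
  obtain ⟨c, rfl⟩ := Submodule.mem_span_singleton.1 hy
  refine ⟨c, ?_⟩
  have htop : t ∈ h.eigenspace (a + b) := by
    rw [Module.End.mem_eigenspace_iff]
    have : t = u - c • m := by rw [← hyt]; abel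
    rw [this, map_sub, map_smul, hhm, show h u = (a + b) • u from huw]
    module
  have hdisj : Disjoint (h.eigenspace (a + b)) T := by
    refine (Module.End.eigenspaces_iSupIndep h (a + b)).mono_right (iSup_le fun k => ?_)
    refine le_iSup₂_of_le (a + b - (k + 1)) ?_ le_rfl
    intro heq
    rw [sub_eq_self] at heq
    exact Nat.cast_add_one_ne_zero k heq
  have : t = 0 := Submodule.disjoint_def.1 hdisj t htop ht
  rw [← hyt, this, add_zero]

end HighestWeight

/-! ### Intertwiners, Schur's lemma and uniqueness for a given highest weight -/

section Intertwiners

variable {V W X : Type*} [AddCommGroup V] [Module ℂ V] [AddCommGroup W] [Module ℂ W]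
  [AddCommGroup X] [Module ℂ X]
  {r : su3 → Module.End ℂ V} {s : su3 → Module.End ℂ W} {t : su3 → Module.End ℂ X}

/-- The action `r` on `V` is irreducible. -/
def IsIrred (r : su3 → Module.End ℂ V) : Prop :=
  Nontrivial V ∧ ∀ U : Submodule ℂ V, (∀ x, ∀ u ∈ U, r x u ∈ U) → U = ⊥ ∨ U = ⊤

/-- The actions `r` and `s` are isomorphic. -/
def Intertwined (r : su3 → Module.End ℂ V) (s : su3 → Module.End ℂ W) : Prop :=
  ∃ g : V ≃ₗ[ℂ] W, ∀ x v, g (r x v) = s x (g v)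

theorem Intertwined.refl (r : su3 → Module.End ℂ V) : Intertwined r r :=
  ⟨LinearEquiv.refl ℂ V, fun _ _ => rfl⟩

theorem Intertwined.symm (h : Intertwined r s) : Intertwined s r := by
  obtain ⟨g, hg⟩ := h
  refine ⟨g.symm, fun x v => ?_⟩
  rw [LinearEquiv.symm_apply_eq, hg, LinearEquiv.apply_symm_apply]

theorem Intertwined.trans (h : Intertwined r s) (h' : Intertwined s t) : Intertwined r t := by
  obtain ⟨g, hg⟩ := h
  obtain ⟨g', hg'⟩ := h'
  exact ⟨g.trans g', fun x v => by simp [hg, hg']⟩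

theorem Intertwined.isRep (h : Intertwined r s) (hs : IsRep s) : IsRep r := by
  obtain ⟨g, hg⟩ := h
  constructor
  · intro x y
    ext v
    apply g.injective
    simp [hg, hs.map_add]
  · intro c x
    ext v
    apply g.injective
    rw [hg, hs.map_smul, LinearMap.smul_apply, LinearMap.smul_apply, map_smul, hg]
  · intro x y
    ext v
    apply g.injective
    simp [hg, hs.map_lie]

theorem Intertwined.isIrred (h : Intertwined r s) (hs : IsIrred s) : IsIrred r := by
  obtain ⟨g, hg⟩ := h
  have := hs.1
  refine ⟨g.toEquiv.nontrivial, fun U hU => ?_⟩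
  have hinv : ∀ x, ∀ u ∈ U.map (g : V →ₗ[ℂ] W), s x u ∈ U.map (g : V →ₗ[ℂ] W) := by
    rintro x _ ⟨u, hu, rfl⟩
    exact ⟨r x u, hU x u hu, hg x u⟩
  have hcomap : (U.map (g : V →ₗ[ℂ] W)).comap (g : V →ₗ[ℂ] W) = U :=
    Submodule.comap_map_eq_of_injective g.injective U
  rcases hs.2 _ hinv with h | h
  · left
    rw [← hcomap, h, Submodule.comap_bot]
    exact LinearMap.ker_eq_bot.2 g.injective
  · right
    rw [← hcomap, h, Submodule.comap_top]

theorem Intertwined.finrank_eq (h : Intertwined r s) : Module.finrank ℂ V = Module.finrank ℂ W :=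
  h.choose.finrank_eq

/-- A nonzero intertwiner between irreducible representations is bijective. -/
theorem bijective_of_isIrred (hr : IsIrred r) (hs : IsIrred s) (f : V →ₗ[ℂ] W)
    (hf : ∀ x v, f (r x v) = s x (f v)) (hne : f ≠ 0) : Function.Bijective f := by
  constructor
  · rw [← LinearMap.ker_eq_bot]
    refine (hr.2 (LinearMap.ker f) fun x u hu => ?_).resolve_right fun h => ?_
    · rw [LinearMap.mem_ker] at hu ⊢
      rw [hf, hu, map_zero]
    · exact hne (LinearMap.ker_eq_top.1 h)
  · rw [← LinearMap.range_eq_top]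
    refine (hs.2 (LinearMap.range f) ?_).resolve_left fun h => ?_
    · rintro x _ ⟨u, rfl⟩
      exact ⟨r x u, hf x u⟩
    · exact hne (LinearMap.range_eq_bot.1 h)

/-- An irreducible representation is determined by its highest weight. -/
theorem intertwined_of_isHighestWeightVector (hr : IsRep r) (hs : IsRep s) (hri : IsIrred r)
    (hsi : IsIrred s) {v : V} {w : W} {a b : ℂ} (hv : IsHighestWeightVector r v a b)
    (hw : IsHighestWeightVector s w a b) : Intertwined r s := by
  -- The subrepresentation `U` of `V × W` generated by `(v, w)` turns out to be the graph of an
  -- isomorphism: both projections from it are bijective.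
  set t : su3 → Module.End ℂ (V × W) := fun x => (r x).prodMap (s x) with ht
  have htrep : IsRep t := by
    constructor
    · intro x y
      ext u <;> simp [ht, hr.map_add, hs.map_add]
    · intro c x
      ext u <;> simp [ht, hr.map_smul, hs.map_smul]
    · intro x y
      ext u <;> simp [ht, hr.map_lie, hs.map_lie]
  have htu (i j : Fin 3) (p : V × W) :
      unitAction t i j p = (unitAction r i j p.1, unitAction s i j p.2) := by
    simp [unitAction, complexify, ht]
  have hm : IsHighestWeightVector t (v, w) a b := by
    refine ⟨fun h => hv.ne_zero (congrArg Prod.fst h), ?_, ?_, ?_, ?_⟩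
    · simp [htu, hv.raise_one, hw.raise_one]
    · simp [htu, hv.raise_two, hw.raise_two]
    · simp [htu, hv.weight_one, hw.weight_one]
    · simp [htu, hv.weight_two, hw.weight_two]
  obtain ⟨U, hmU, hinv, hone⟩ := htrep.exists_cyclic hm
  have hadd1 : unitAction r 0 0 v - unitAction r 2 2 v = (a + b) • v := by
    rw [add_smul, ← hv.weight_one, ← hv.weight_two]
    abel
  have hadd2 : unitAction s 0 0 w - unitAction s 2 2 w = (a + b) • w := by
    rw [add_smul, ← hw.weight_one, ← hw.weight_two]
    abel
  -- Otherwise irreducibility puts all of `V × 0` in `U`, so `(v, 0)` is in the top weight space of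
  -- `U` and is a multiple of `(v, w)`, which is impossible.
  have hinl : U.comap (LinearMap.inl ℂ V W) = ⊥ := by
    refine (hri.2 _ fun x u hu => ?_).resolve_right fun h => ?_
    · have := hinv x _ hu
      simpa [ht] using this
    · have hvU : (v, (0 : W)) ∈ U := by
        have : v ∈ U.comap (LinearMap.inl ℂ V W) := h ▸ Submodule.mem_top
        simpa using this
      obtain ⟨c, hc⟩ := hone _ hvU (by simp [htu, hadd1])
      simp only [Prod.smul_mk, Prod.mk.injEq] at hc
      rcases smul_eq_zero.1 hc.2.symm with h0 | h0
      · exact hv.ne_zero (by rw [hc.1, h0, zero_smul])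
      · exact hw.ne_zero h0
  have hinr : U.comap (LinearMap.inr ℂ V W) = ⊥ := by
    refine (hsi.2 _ fun x u hu => ?_).resolve_right fun h => ?_
    · have := hinv x _ hu
      simpa [ht] using this
    · have hwU : ((0 : V), w) ∈ U := by
        have : w ∈ U.comap (LinearMap.inr ℂ V W) := h ▸ Submodule.mem_top
        simpa using this
      obtain ⟨c, hc⟩ := hone _ hwU (by simp [htu, hadd2])
      simp only [Prod.smul_mk, Prod.mk.injEq] at hc
      rcases smul_eq_zero.1 hc.1.symm with h0 | h0
      · exact hw.ne_zero (by rw [hc.2, h0, zero_smul])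
      · exact hv.ne_zero h0
  have hfst : Function.Bijective ((LinearMap.fst ℂ V W).comp U.subtype) := by
    constructor
    · rw [← LinearMap.ker_eq_bot, LinearMap.ker_eq_bot']
      rintro ⟨⟨p, q⟩, hpq⟩ hp
      obtain rfl : p = 0 := hp
      have : q ∈ U.comap (LinearMap.inr ℂ V W) := hpq
      rw [hinr, Submodule.mem_bot] at this
      subst this
      rfl
    · rw [← LinearMap.range_eq_top]
      refine (hri.2 _ ?_).resolve_left fun h => ?_
      · rintro x _ ⟨u, rfl⟩
        exact ⟨⟨t x u, hinv x u u.2⟩, rfl⟩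
      · have : v ∈ LinearMap.range ((LinearMap.fst ℂ V W).comp U.subtype) := ⟨⟨(v, w), hmU⟩, rfl⟩
        rw [h, Submodule.mem_bot] at this
        exact hv.ne_zero this
  have hsnd : Function.Bijective ((LinearMap.snd ℂ V W).comp U.subtype) := by
    constructor
    · rw [← LinearMap.ker_eq_bot, LinearMap.ker_eq_bot']
      rintro ⟨⟨p, q⟩, hpq⟩ hq
      obtain rfl : q = 0 := hq
      have : p ∈ U.comap (LinearMap.inl ℂ V W) := hpq
      rw [hinl, Submodule.mem_bot] at this
      subst this
      rfl
    · rw [← LinearMap.range_eq_top]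
      refine (hsi.2 _ ?_).resolve_left fun h => ?_
      · rintro x _ ⟨u, rfl⟩
        exact ⟨⟨t x u, hinv x u u.2⟩, rfl⟩
      · have : w ∈ LinearMap.range ((LinearMap.snd ℂ V W).comp U.subtype) := ⟨⟨(v, w), hmU⟩, rfl⟩
        rw [h, Submodule.mem_bot] at this
        exact hw.ne_zero this
  let tU : su3 → Module.End ℂ U := fun x => (t x).restrict (hinv x)
  have i1 : Intertwined tU r := ⟨LinearEquiv.ofBijective _ hfst, fun _ _ => rfl⟩
  have i2 : Intertwined tU s := ⟨LinearEquiv.ofBijective _ hsnd, fun _ _ => rfl⟩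
  exact i1.symm.trans i2

/-- The space of intertwiners between two actions. -/
def intertwiners (r : su3 → Module.End ℂ V) (s : su3 → Module.End ℂ W) :
    Submodule ℂ (V →ₗ[ℂ] W) where
  carrier := {f | ∀ x v, f (r x v) = s x (f v)}
  add_mem' := by
    intro f g hf hg x v
    simp [hf x v, hg x v]
  zero_mem' := by
    intro x v
    simp
  smul_mem' := by
    intro c f hf x v
    simp [hf x v]

open Classical in
/-- Schur's lemma: the dimension of the space of intertwiners between irreducible
representations. -/
theorem finrank_intertwiners_of_isIrred [FiniteDimensional ℂ V] (hr : IsIrred r)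
    (hs : IsIrred s) :
    Module.finrank ℂ (intertwiners r s) = if Intertwined r s then 1 else 0 := by
  have := hr.1
  have := hs.1
  split_ifs with h
  · obtain ⟨g, hg⟩ := h
    rw [finrank_eq_one_iff_of_nonzero' (⟨g, hg⟩ : intertwiners r s)]
    · rintro ⟨f, hf⟩
      -- For an eigenvalue `c` of `g⁻¹ f`, the intertwiner `f - c g` has a nonzero kernel, so it
      -- cannot be bijective and must vanish.
      obtain ⟨c, hc⟩ := Module.End.exists_eigenvalue ((g.symm : W →ₗ[ℂ] V).comp f)
      obtain ⟨v, hv⟩ := hc.exists_hasEigenvector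
      refine ⟨c, Subtype.ext ?_⟩
      change c • (g : V →ₗ[ℂ] W) = f
      by_contra hne
      have hbij := bijective_of_isIrred hr hs (f - c • (g : V →ₗ[ℂ] W))
        (fun x u => by simp [hf x u, hg x u]) (sub_ne_zero.2 (Ne.symm hne))
      refine hv.2 (hbij.injective ?_)
      have hfv : f v = c • g v := by
        have := hv.apply_eq_smul
        simpa [LinearEquiv.symm_apply_eq] using this
      simp [hfv]
    · intro h0
      have h0' : (g : V →ₗ[ℂ] W) = 0 := congrArg Subtype.val h0
      obtain ⟨v, hv⟩ := exists_ne (0 : V)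
      exact hv (g.injective (by simpa using congrArg (fun f : V →ₗ[ℂ] W => f v) h0'))
  · have hbot : intertwiners r s = ⊥ := by
      rw [eq_bot_iff]
      intro f hf
      rw [Submodule.mem_bot]
      by_contra hne
      exact h ⟨LinearEquiv.ofBijective f (bijective_of_isIrred hr hs f hf hne), hf⟩
    rw [hbot, finrank_bot]

/-- Isomorphic actions have intertwiner spaces of equal dimension. -/
theorem Intertwined.finrank_intertwiners_eq (h : Intertwined s t) (r : su3 → Module.End ℂ V) :
    Module.finrank ℂ (intertwiners r s) = Module.finrank ℂ (intertwiners r t) := by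
  obtain ⟨g, hg⟩ := h
  have hg' (x) (u) : g.symm (t x u) = s x (g.symm u) := by
    rw [LinearEquiv.symm_apply_eq, hg, LinearEquiv.apply_symm_apply]
  refine LinearEquiv.finrank_eq (LinearEquiv.ofLinearMap
    (LinearMap.codRestrict _ ((LinearMap.compRight ℂ (g : W →ₗ[ℂ] X)).comp (Submodule.subtype _))
      ?_)
    (LinearMap.codRestrict _ ((LinearMap.compRight ℂ (g.symm : X →ₗ[ℂ] W)).comp
      (Submodule.subtype _)) ?_) ?_ ?_)
  · rintro ⟨f, hf⟩ x v
    have := hf x v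
    simp [this, hg]
  · rintro ⟨f, hf⟩ x v
    have := hf x v
    simp [this, hg']
  · ext f v
    simp
  · ext f v
    simp

/-- The direct product of a family of actions. -/
def piAction {ι : Type*} {M : ι → Type*} [∀ i, AddCommGroup (M i)] [∀ i, Module ℂ (M i)]
    (σ : ∀ i, su3 → Module.End ℂ (M i)) (x : su3) : Module.End ℂ (∀ i, M i) :=
  LinearMap.pi fun i => (σ i x).comp (LinearMap.proj i)

theorem finrank_intertwiners_piAction {ι : Type*} [Fintype ι] [FiniteDimensional ℂ V]
    {M : ι → Type*}
    [∀ i, AddCommGroup (M i)] [∀ i, Module ℂ (M i)] [∀ i, FiniteDimensional ℂ (M i)]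
    (r : su3 → Module.End ℂ V) (σ : ∀ i, su3 → Module.End ℂ (M i)) :
    Module.finrank ℂ (intertwiners r (piAction σ)) =
      ∑ i, Module.finrank ℂ (intertwiners r (σ i)) := by
  rw [← Module.finrank_pi_fintype]
  refine LinearEquiv.finrank_eq (LinearEquiv.ofBijective (LinearMap.pi fun i =>
    LinearMap.codRestrict (intertwiners r (σ i))
      ((LinearMap.compRight ℂ (LinearMap.proj i)).comp (Submodule.subtype _)) ?_) ?_)
  · rintro ⟨f, hf⟩ x v
    have := congrFun (hf x v) i
    simpa [piAction] using this
  · constructor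
    · intro f g hfg
      ext v i
      have := congrArg (fun f : V →ₗ[ℂ] M i => f v) (congrArg Subtype.val (congrFun hfg i))
      simpa using this
    · intro f
      refine ⟨⟨LinearMap.pi fun i => (f i : V →ₗ[ℂ] M i), fun x v => ?_⟩, ?_⟩
      · ext i
        have := (f i).2 x v
        simpa [piAction] using this
      · ext i v
        simp

theorem IsRep.piAction {ι : Type*} {M : ι → Type*} [∀ i, AddCommGroup (M i)]
    [∀ i, Module ℂ (M i)] {σ : ∀ i, su3 → Module.End ℂ (M i)} (h : ∀ i, IsRep (σ i)) :
    IsRep (piAction σ) := by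
  constructor
  · intro x y
    refine LinearMap.ext fun v => funext fun i => ?_
    simp [_root_.piAction, (h i).map_add]
  · intro c x
    refine LinearMap.ext fun v => funext fun i => ?_
    simp [_root_.piAction, (h i).map_smul]
  · intro x y
    refine LinearMap.ext fun v => funext fun i => ?_
    simp [_root_.piAction, (h i).map_lie]

/-- Direct products of isomorphic families, up to reindexing, are isomorphic. -/
theorem intertwined_piAction {ι κ : Type*} {M : ι → Type*} {M' : κ → Type*}
    [∀ i, AddCommGroup (M i)] [∀ i, Module ℂ (M i)]
    [∀ i, AddCommGroup (M' i)] [∀ i, Module ℂ (M' i)]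
    {σ : ∀ i, su3 → Module.End ℂ (M i)} {σ' : ∀ i, su3 → Module.End ℂ (M' i)} (e : ι ≃ κ)
    (h : ∀ i, Intertwined (σ i) (σ' (e i))) : Intertwined (piAction σ) (piAction σ') := by
  choose g hg using h
  refine ⟨(LinearEquiv.piCongrRight g).trans (LinearEquiv.piCongrLeft ℂ M' e), fun x v => ?_⟩
  ext k
  obtain ⟨i, rfl⟩ := e.surjective k
  have key (w : ∀ i, M' (e i)) : LinearEquiv.piCongrLeft ℂ M' e w (e i) = w i :=
    Equiv.piCongrLeft_apply_apply M' e w i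
  change LinearEquiv.piCongrLeft ℂ M' e (LinearEquiv.piCongrRight g (piAction σ x v)) (e i) =
    σ' (e i) x (LinearEquiv.piCongrLeft ℂ M' e (LinearEquiv.piCongrRight g v) (e i))
  rw [key, key]
  exact hg i x (v i)

end Intertwiners

/-! ### Irreducible classes: finiteness, representatives, transport to `ℂ^D` -/

namespace SU3Rep

variable {D : ℕ}

theorem isRep (ρ : SU3Rep D) : IsRep (fun x => ρ x) where
  map_add x y := _root_.map_add ρ x y
  map_smul c x := by
    refine LinearMap.ext fun v => ?_
    simp
  map_lie x y := by
    rw [LieHom.map_lie, Ring.lie_def]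

theorem IsIrreducible.isIrred {ρ : SU3Rep D} (h : ρ.IsIrreducible) : IsIrred (fun x => ρ x) :=
  ⟨(Submodule.nontrivial_iff ℂ).1 ⟨⊤, ⊥, h.2.1⟩, fun U hU => h.2.2 U hU le_top⟩

theorem isIrreducible_of_isIrred {ρ : SU3Rep D} (h : IsIrred (fun x => ρ x)) :
    ρ.IsIrreducible := by
  have := h.1
  exact ⟨fun _ _ _ => Submodule.mem_top, top_ne_bot, fun U hU _ => h.2 U hU⟩

theorem exists_eq_of_isRep {r : su3 → Module.End ℂ (Fin D → ℂ)} (hr : IsRep r) :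
    ∃ ρ : SU3Rep D, (fun x => ρ x) = r := by
  refine ⟨{ toFun := r, map_add' := hr.map_add, map_smul' := fun c x => ?_, map_lie' := ?_ }, rfl⟩
  · rw [hr.map_smul]
    refine LinearMap.ext fun v => ?_
    simp
  · intro x y
    rw [Ring.lie_def]
    exact hr.map_lie x y

end SU3Rep

/-- The highest weight, a pair of naturals below `d`, determines the class, so the classes inject
into `Fin d × Fin d`. -/
theorem irrepClasses_finite (d : ℕ) : (irrepClasses d).Finite := by
  have key (c : irrepClasses d) : ∃ (ρ : SU3Rep d) (p : Fin d × Fin d), ρ.IsIrreducible ∧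
      Quotient.mk _ ρ = c.1 ∧
      ∃ v, IsHighestWeightVector (fun x => ρ x) v ((p.1 : ℕ) : ℂ) ((p.2 : ℕ) : ℂ) := by
    obtain ⟨ρ, hρ, hc⟩ := c.2
    have := hρ.isIrred.1
    obtain ⟨v, a, b, hv⟩ := ρ.isRep.exists_isHighestWeightVector
    obtain ⟨⟨n, hn, rfl⟩, k, hk, rfl⟩ := ρ.isRep.exists_nat_of_isHighestWeightVector hv
    rw [Module.finrank_fin_fun] at hn hk
    exact ⟨ρ, (⟨n, hn⟩, ⟨k, hk⟩), hρ, hc, v, hv⟩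
  choose ρ p hirr hmk v hv using key
  have hinj : Function.Injective p := by
    intro c c' hcc
    refine Subtype.ext ?_
    rw [← hmk c, ← hmk c']
    refine Quotient.sound ?_
    have h1 := hv c
    rw [hcc] at h1
    exact intertwined_of_isHighestWeightVector (ρ c).isRep (ρ c').isRep (hirr c).isIrred
      (hirr c').isIrred h1 (hv c')
  have := Finite.of_injective p hinj
  exact Set.toFinite _

/-- The equivalence classes of irreducible representations of `su(3)`, of all dimensions. -/
abbrev IrrepClass : Type := Σ d : ℕ, irrepClasses d

namespace IrrepClass

noncomputable instance : DecidableEq IrrepClass := Classical.decEq _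

/-- A representative of a class of irreducible representations. -/
noncomputable def rep (c : IrrepClass) : SU3Rep c.1 := c.2.2.choose

/-- The action of `su(3)` on the representative of a class. -/
noncomputable def action (c : IrrepClass) (x : su3) : Module.End ℂ (Fin c.1 → ℂ) := c.rep x

theorem isRep_action (c : IrrepClass) : IsRep c.action := c.rep.isRep

theorem isIrred_action (c : IrrepClass) : IsIrred c.action :=
  SU3Rep.IsIrreducible.isIrred c.2.2.choose_spec.1

theorem mk_rep (c : IrrepClass) : Quotient.mk (SU3Rep.setoid c.1) c.rep = c.2 :=
  c.2.2.choose_spec.2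

theorem intertwined_action_iff {c c' : IrrepClass} :
    Intertwined c.action c'.action ↔ c = c' := by
  constructor
  · intro h
    have hd := h.finrank_eq
    rw [Module.finrank_fin_fun, Module.finrank_fin_fun] at hd
    obtain ⟨d, c, hc⟩ := c
    obtain ⟨d', c', hc'⟩ := c'
    obtain rfl : d = d' := hd
    have h1 := mk_rep ⟨d, c, hc⟩
    have h2 := mk_rep ⟨d, c', hc'⟩
    have h3 : Quotient.mk (SU3Rep.setoid d) (rep ⟨d, c, hc⟩) =
      Quotient.mk (SU3Rep.setoid d) (rep ⟨d, c', hc'⟩) := Quotient.sound h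
    have : c = c' := h1.symm.trans (h3.trans h2)
    subst this
    rfl
  · rintro rfl
    exact Intertwined.refl _

theorem fst_pos (c : IrrepClass) : 0 < c.1 := by
  have := c.isIrred_action.1
  rw [← Module.finrank_fin_fun ℂ (n := c.1)]
  exact Module.finrank_pos

end IrrepClass

section Transport

variable {V : Type*} [AddCommGroup V] [Module ℂ V] {r : su3 → Module.End ℂ V}

theorem IsRep.exists_intertwined [FiniteDimensional ℂ V] (hr : IsRep r) {D : ℕ}
    (hD : Module.finrank ℂ V = D) : ∃ ρ : SU3Rep D, Intertwined (fun x => ρ x) r := by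
  obtain ⟨g⟩ : Nonempty ((Fin D → ℂ) ≃ₗ[ℂ] V) :=
    FiniteDimensional.nonempty_linearEquiv_of_finrank_eq (by rw [Module.finrank_fin_fun, hD])
  have hg : Intertwined (fun x => (g.symm : V →ₗ[ℂ] _) ∘ₗ r x ∘ₗ (g : _ →ₗ[ℂ] V)) r :=
    ⟨g, fun x v => by simp⟩
  obtain ⟨ρ, hρ⟩ := SU3Rep.exists_eq_of_isRep (hg.isRep hr)
  exact ⟨ρ, hρ ▸ hg⟩

theorem IsIrred.exists_irrepClass [FiniteDimensional ℂ V] (h : IsIrred r) (hr : IsRep r) :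
    ∃ c : IrrepClass, Intertwined r c.action := by
  obtain ⟨ρ, hρ⟩ := hr.exists_intertwined rfl
  have hirr := SU3Rep.isIrreducible_of_isIrred (hρ.isIrred h)
  let c : IrrepClass := ⟨_, Quotient.mk _ ρ, ρ, hirr, rfl⟩
  refine ⟨c, hρ.symm.trans ?_⟩
  have : Quotient.mk (SU3Rep.setoid _) ρ = Quotient.mk (SU3Rep.setoid _) c.rep := c.mk_rep.symm
  exact Quotient.exact this

theorem IsRep.restrict (hr : IsRep r) {U : Submodule ℂ V} (hU : ∀ x, ∀ u ∈ U, r x u ∈ U) :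
    IsRep (fun x => (r x).restrict (hU x)) := by
  constructor
  · intro x y
    refine LinearMap.ext fun v => Subtype.ext ?_
    simp [hr.map_add]
  · intro c x
    refine LinearMap.ext fun v => Subtype.ext ?_
    simp [hr.map_smul]
  · intro x y
    refine LinearMap.ext fun v => Subtype.ext ?_
    simp [hr.map_lie]

end Transport

/-! ### Sums of irreducibles as multisets of classes -/

/-- The direct sum of the irreducible representations in a multiset of classes. -/
noncomputable def multisetAction (m : Multiset IrrepClass) :
    su3 → Module.End ℂ (∀ i : m, Fin (i : IrrepClass).1 → ℂ) :=
  piAction fun i : m => (i : IrrepClass).action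

theorem isRep_multisetAction (m : Multiset IrrepClass) : IsRep (multisetAction m) :=
  IsRep.piAction fun i => (i : IrrepClass).isRep_action

theorem sum_coe_multiset {α : Type*} [DecidableEq α] (m : Multiset α) (f : α → ℕ) :
    ∑ i : m, f i = (m.map f).sum := by
  rw [← Multiset.map_univ m f]
  rfl

theorem finrank_multiset (m : Multiset IrrepClass) :
    Module.finrank ℂ (∀ i : m, Fin (i : IrrepClass).1 → ℂ) = (m.map Sigma.fst).sum := by
  rw [Module.finrank_pi_fintype, ← sum_coe_multiset]
  simp

/-- Intertwiners into a product split as a product, and by Schur each summand contributes one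
exactly when its class is `c`. This makes the multiset an isomorphism invariant. -/
theorem finrank_intertwiners_multisetAction (c : IrrepClass) (m : Multiset IrrepClass) :
    Module.finrank ℂ (intertwiners c.action (multisetAction m)) = m.count c := by
  classical
  rw [multisetAction, finrank_intertwiners_piAction]
  refine (Finset.sum_congr rfl fun (i : m) _ => finrank_intertwiners_of_isIrred c.isIrred_action
    (i : IrrepClass).isIrred_action).trans ?_
  refine (sum_coe_multiset m fun i => if Intertwined c.action i.action then 1 else 0).trans ?_
  simp only [IrrepClass.intertwined_action_iff]
  induction m using Multiset.induction_on with
  | empty => simp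
  | cons a m ih => rw [Multiset.map_cons, Multiset.sum_cons, ih, Multiset.count_cons, add_comm]

theorem eq_of_intertwined_multisetAction {m m' : Multiset IrrepClass}
    (h : Intertwined (multisetAction m) (multisetAction m')) : m = m' := by
  classical
  ext c
  rw [← finrank_intertwiners_multisetAction, ← finrank_intertwiners_multisetAction,
    h.finrank_intertwiners_eq]

theorem SU3Rep.PreservesVector.exists_intertwined_multisetAction {D N : ℕ} {ρ : SU3Rep D}
    (h : ρ.PreservesVector N) :
    ∃ m : Multiset IrrepClass, m.card = N ∧ Intertwined (fun x => ρ x) (multisetAction m) := by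
  classical
  obtain ⟨W, hW, hirr⟩ := h
  let σ (i : Fin N) (x : su3) : Module.End ℂ (W i) := (ρ x).restrict ((hirr i).1 x)
  have hσirr (i) : IsIrred (σ i) := by
    refine ⟨(Submodule.nontrivial_iff_ne_bot).2 (hirr i).2.1, fun U hU => ?_⟩
    have hinv : SU3Rep.IsInvariant ρ (U.map (W i).subtype) := by
      rintro x _ ⟨u, hu, rfl⟩
      exact ⟨_, hU x u hu, rfl⟩
    rcases (hirr i).2.2 _ hinv (Submodule.map_subtype_le _ _) with h | h
    · left
      rw [← Submodule.comap_map_eq_of_injective (Submodule.subtype_injective (W i)) U, h]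
      simp
    · right
      rw [← Submodule.comap_map_eq_of_injective (Submodule.subtype_injective (W i)) U, h]
      simp
  choose c hc using fun i => (hσirr i).exists_irrepClass (ρ.isRep.restrict (hirr i).1)
  -- The type of a multiset consists of elements tagged by a copy index; in `univ.val` every element
  -- occurs once, so the tags carry no information.
  have hbij : Function.Bijective fun i : (Finset.univ.val : Multiset (Fin N)) => (i : Fin N) := by
    rw [Fintype.bijective_iff_surjective_and_card]
    refine ⟨fun i => ?_, by simp [Multiset.card_coe]⟩
    exact ⟨Multiset.mkToType _ i ⟨0, Multiset.count_pos.2 (Finset.mem_univ i)⟩, rfl⟩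
  let e : Fin N ≃ (Finset.univ.val.map c : Multiset IrrepClass) :=
    (Equiv.ofBijective _ hbij).symm.trans (Multiset.mapEquiv _ c)
  have he (i) : ((e i : (Finset.univ.val.map c : Multiset IrrepClass)) : IrrepClass) = c i := by
    rw [Equiv.trans_apply, Multiset.mapEquiv_apply]
    exact congrArg c ((Equiv.ofBijective _ hbij).apply_symm_apply i)
  refine ⟨Finset.univ.val.map c, by simp, ?_⟩
  have h1 : Intertwined (piAction σ) (fun x => ρ x) := by
    refine ⟨(DirectSum.linearEquivFunOnFintype ℂ (Fin N) fun i => W i).symm.trans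
      (LinearEquiv.ofBijective (DirectSum.coeLinearMap W) hW), fun x v => ?_⟩
    have key (v : ∀ i, W i) : ((DirectSum.linearEquivFunOnFintype ℂ (Fin N) fun i => W i).symm.trans
      (LinearEquiv.ofBijective (DirectSum.coeLinearMap W) hW)) v = ∑ i, (v i : Fin D → ℂ) := by
      conv_lhs => rw [← Finset.univ_sum_single v, map_sum]
      refine Finset.sum_congr rfl fun i _ => ?_
      rw [LinearEquiv.trans_apply, DirectSum.linearEquivFunOnFintype_symm_single]
      exact DirectSum.coeLinearMap_lof W i (v i)
    rw [key, key, map_sum]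
    rfl
  refine h1.symm.trans (intertwined_piAction e fun i => ?_)
  rw [he]
  exact hc i

theorem isInternal_range_single {ι κ V : Type*} [Fintype ι] [DecidableEq ι] [Fintype κ]
    [DecidableEq κ] [AddCommGroup V] [Module ℂ V] {M : ι → Type*} [∀ i, AddCommGroup (M i)]
    [∀ i, Module ℂ (M i)] (g : V ≃ₗ[ℂ] ∀ i, M i) (e : κ ≃ ι) :
    DirectSum.IsInternal fun k =>
      LinearMap.range ((g.symm : (∀ i, M i) →ₗ[ℂ] V) ∘ₗ LinearMap.single ℂ M (e k)) := by
  apply DirectSum.isInternal_submodule_of_iSupIndep_of_iSup_eq_top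
  · intro k
    rw [Submodule.disjoint_def]
    rintro _ ⟨y, rfl⟩ hy
    -- All the other summands have zero coordinate at `e k`, which forces independence.
    have hle : (⨆ j, ⨆ (_ : j ≠ k), LinearMap.range
        ((g.symm : (∀ i, M i) →ₗ[ℂ] V) ∘ₗ LinearMap.single ℂ M (e j))) ≤
        LinearMap.ker (LinearMap.proj (e k) ∘ₗ (g : V →ₗ[ℂ] ∀ i, M i)) := by
      refine iSup₂_le fun j hj => ?_
      rintro _ ⟨z, rfl⟩
      simp [Pi.single_eq_of_ne (e.injective.ne hj.symm)]
    have := hle hy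
    have hy0 : y = 0 := by simpa using this
    rw [hy0, map_zero]
  · rw [eq_top_iff]
    intro v _
    have hv : v = ∑ k, g.symm (Pi.single (e k) (g v (e k))) := by
      rw [e.sum_comp fun i => g.symm (Pi.single i (g v i)), ← map_sum, Finset.univ_sum_single,
        LinearEquiv.symm_apply_apply]
    rw [hv]
    exact Submodule.sum_mem _ fun k _ => Submodule.mem_iSup_of_mem k ⟨g v (e k), rfl⟩

theorem SU3Rep.preservesVector_of_intertwined {D : ℕ} {ρ : SU3Rep D} {m : Multiset IrrepClass}
    (h : Intertwined (fun x => ρ x) (multisetAction m)) : ρ.PreservesVector m.card := by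
  classical
  obtain ⟨g, hg⟩ := h
  have e : Fin m.card ≃ m := (Fintype.equivFinOfCardEq (Multiset.card_coe m)).symm
  let f (i : m) : (Fin (i : IrrepClass).1 → ℂ) →ₗ[ℂ] (Fin D → ℂ) :=
    (g.symm : (∀ i : m, Fin (i : IrrepClass).1 → ℂ) →ₗ[ℂ] _) ∘ₗ
      LinearMap.single ℂ (fun i : m => Fin (i : IrrepClass).1 → ℂ) i
  have hf (i : m) (x) (u) : f i ((i : IrrepClass).action x u) = ρ x (f i u) := by
    apply g.injective
    rw [hg]
    simp only [f, LinearMap.comp_apply, LinearEquiv.coe_coe, LinearEquiv.apply_symm_apply]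
    ext j : 1
    by_cases hj : j = i
    · subst hj
      simp [multisetAction, piAction]
    · simp [multisetAction, piAction, Pi.single_eq_of_ne hj]
  have hfinj (i : m) : Function.Injective (f i) :=
    fun _ _ h => Pi.single_injective (M := fun i : m => Fin (i : IrrepClass).1 → ℂ) i
      (g.symm.injective h)
  refine ⟨fun k => LinearMap.range (f (e k)), ?_, fun k => ⟨?_, ?_, ?_⟩⟩
  · exact isInternal_range_single g e
  · rintro x _ ⟨u, rfl⟩
    exact ⟨_, hf _ x u⟩
  · intro hbot
    have := (e k : IrrepClass).isIrred_action.1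
    obtain ⟨u, hu⟩ := exists_ne (0 : Fin (e k : IrrepClass).1 → ℂ)
    have h0 : f (e k) = 0 := LinearMap.range_eq_bot.1 hbot
    exact hu (hfinj (e k) (by rw [h0]; rfl))
  · intro U hU hle
    have hmap : (U.comap (f (e k))).map (f (e k)) = U := Submodule.map_comap_eq_self hle
    rcases (e k : IrrepClass).isIrred_action.2 (U.comap (f (e k))) fun x u hu => by
      rw [Submodule.mem_comap, hf]
      exact hU x _ hu with h | h
    · left
      rw [← hmap, h, Submodule.map_bot]
    · right
      rw [← hmap, h, Submodule.map_top]

/-- Classes of representations that are direct sums of `N` irreducible representations correspond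
to multisets of `N` classes of irreducible representations. -/
theorem exists_equiv_preservingClasses (D N : ℕ) :
    Nonempty ({m : Multiset IrrepClass // m.card = N ∧ (m.map Sigma.fst).sum = D} ≃
      preservingClasses D N) := by
  choose ρ hρ using fun m : {m : Multiset IrrepClass //
    m.card = N ∧ (m.map Sigma.fst).sum = D} =>
      (isRep_multisetAction m.1).exists_intertwined ((finrank_multiset m.1).trans m.2.2)
  refine ⟨Equiv.ofBijective (fun m => ⟨Quotient.mk _ (ρ m), ρ m,
    m.2.1 ▸ SU3Rep.preservesVector_of_intertwined (hρ m), rfl⟩) ⟨?_, ?_⟩⟩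
  · intro m m' h
    have h1 : Intertwined (fun x => ρ m x) (fun x => ρ m' x) :=
      Quotient.exact (congrArg Subtype.val h)
    exact Subtype.ext (eq_of_intertwined_multisetAction ((hρ m).symm.trans (h1.trans (hρ m'))))
  · rintro ⟨_, σ, hσ, rfl⟩
    obtain ⟨m, hm, hσm⟩ := hσ.exists_intertwined_multisetAction
    have hD : (m.map Sigma.fst).sum = D := by
      rw [← finrank_multiset, ← hσm.finrank_eq, Module.finrank_fin_fun]
    refine ⟨⟨m, hm, hD⟩, Subtype.ext (Quotient.sound ?_)⟩
    exact (hρ ⟨m, hm, hD⟩).trans hσm.symm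

/-! ### Counting multisets with prescribed first components -/

section Counting

variable {J : ℕ → Type*}

theorem Multiset.exists_map_sigmaMk_eq {d : ℕ} (m : Multiset (Σ d, J d)) (h : ∀ x ∈ m, x.1 = d) :
    ∃ p : Multiset (J d), p.map (Sigma.mk d) = m := by
  induction m using Multiset.induction_on with
  | empty => exact ⟨0, rfl⟩
  | cons a m ih =>
    obtain ⟨p, rfl⟩ := ih fun x hx => h x (Multiset.mem_cons_of_mem hx)
    obtain ⟨d', j⟩ := a
    obtain rfl : d' = d := h _ (Multiset.mem_cons_self _ _)
    exact ⟨j ::ₘ p, by simp⟩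

/-- Multisets of pairs with prescribed first components correspond to families of multisets of
second components. -/
theorem nonempty_equiv_multiset_map_fst (s : Multiset ℕ) :
    Nonempty ((∀ d : s.toFinset, Sym (J d) (s.count (d : ℕ))) ≃
      {m : Multiset (Σ d, J d) // m.map Sigma.fst = s}) := by
  classical
  refine ⟨Equiv.ofBijective (fun f => ⟨∑ d : s.toFinset, (f d : Multiset (J d)).map (Sigma.mk (d : ℕ)), ?_⟩)
    ⟨?_, ?_⟩⟩
  · rw [← Multiset.coe_mapAddMonoidHom, map_sum]
    simp only [Multiset.coe_mapAddMonoidHom, Multiset.map_map, Function.comp_def,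
      Multiset.map_const', Sym.card_coe]
    rw [Finset.sum_coe_sort s.toFinset fun d => Multiset.replicate (s.count d) d]
    simp only [← Multiset.nsmul_singleton]
    exact Multiset.toFinset_sum_count_nsmul_eq s
  · intro f f' h
    have h' := congrArg Subtype.val h
    funext d
    refine Sym.coe_injective (Multiset.ext.2 fun j => ?_)
    -- Only the summand of index `d` contains pairs with first component `d`, so the sum determines
    -- each multiset of the family.
    have key (f : ∀ d : s.toFinset, Sym (J d) (s.count (d : ℕ))) :
        Multiset.count ⟨d, j⟩ (∑ d : s.toFinset, (f d : Multiset (J d)).map (Sigma.mk (d : ℕ))) =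
          Multiset.count j (f d : Multiset (J d)) := by
      rw [Multiset.count_sum', Finset.sum_eq_single d]
      · exact Multiset.count_map_eq_count' _ _ sigma_mk_injective j
      · intro d' _ hne
        rw [Multiset.count_eq_zero, Multiset.mem_map]
        rintro ⟨i, _, hi⟩
        exact hne (Subtype.ext (congrArg Sigma.fst hi))
      · simp
    rw [← key f, ← key f']
    exact congrArg _ h'
  · rintro ⟨m, rfl⟩
    choose p hp using fun d => Multiset.exists_map_sigmaMk_eq (d := d)
      (m.filter fun x : Σ d, J d => x.1 = d) fun x hx => (Multiset.mem_filter.1 hx).2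
    have hcard (d : ℕ) : (p d).card = (m.map Sigma.fst).count d := by
      rw [← Multiset.card_map (Sigma.mk d), hp, Multiset.count_map]
      simp only [eq_comm]
    refine ⟨fun d => ⟨p d, hcard d⟩, Subtype.ext (Multiset.ext.2 fun x => ?_)⟩
    change Multiset.count x (∑ d : (m.map Sigma.fst).toFinset, (p d).map (Sigma.mk (d : ℕ))) = _
    simp only [hp]
    rw [Finset.sum_coe_sort (m.map Sigma.fst).toFinset fun d => m.filter fun x => x.1 = d,
      Multiset.count_sum', Finset.sum_eq_single x.1]
    · exact Multiset.count_filter_of_pos (p := fun y : Σ d, J d => y.1 = x.1) rfl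
    · intro d _ hne
      exact Multiset.count_filter_of_neg hne.symm
    · intro hx
      rw [Multiset.count_eq_zero]
      intro hxm
      exact hx (Multiset.mem_toFinset.2 (Multiset.mem_map_of_mem _ (Multiset.mem_filter.1 hxm).1))

theorem finite_multiset_map_fst [∀ d, Finite (J d)] (s : Multiset ℕ) :
    Finite {m : Multiset (Σ d, J d) // m.map Sigma.fst = s} := by
  have hJ (d : ℕ) : Fintype (J d) := Fintype.ofFinite _
  classical
  exact Finite.of_equiv _ (nonempty_equiv_multiset_map_fst s).some

/-- The choices for distinct first components are independent, and `Sym` counts each of them by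
stars and bars. -/
theorem card_multiset_map_fst [∀ d, Finite (J d)] (s : Multiset ℕ) :
    Nat.card {m : Multiset (Σ d, J d) // m.map Sigma.fst = s} =
      ∏ d ∈ s.toFinset, (s.count d + Nat.card (J d) - 1).choose (s.count d) := by
  have hJ (d : ℕ) : Fintype (J d) := Fintype.ofFinite _
  classical
  rw [← Nat.card_congr (nonempty_equiv_multiset_map_fst s).some, Nat.card_pi,
    Finset.prod_coe_sort s.toFinset fun d => Nat.card (Sym (J d) (s.count d))]
  refine Finset.prod_congr rfl fun d _ => ?_
  rw [Nat.card_eq_fintype_card, Sym.card_sym_eq_choose, Nat.card_eq_fintype_card, add_comm]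

end Counting

/-! ### Fibring over partitions and the final count -/

instance (d : ℕ) : Finite (irrepClasses d) := (irrepClasses_finite d).to_subtype

theorem IrrepClass.fst_mem_R3 (c : IrrepClass) : c.1 ∈ R3 :=
  Set.ncard_ne_zero_of_mem c.2.2 (irrepClasses_finite c.1)

theorem mem_partitionsR3 {D N : ℕ} {P : Nat.Partition D} :
    P ∈ partitionsR3 D N ↔ (∀ p ∈ P.parts, p ∈ R3) ∧ P.parts.card = N := by
  simp [partitionsR3]

/-- The dimensions of the members of a multiset of classes form a partition into parts in `R₃`. -/
def dimPartition {D N : ℕ}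
    (m : {m : Multiset IrrepClass // m.card = N ∧ (m.map Sigma.fst).sum = D}) :
    partitionsR3 D N :=
  ⟨{ parts := m.1.map Sigma.fst
     parts_pos := by
      intro i hi
      obtain ⟨c, _, rfl⟩ := Multiset.mem_map.1 hi
      exact IrrepClass.fst_pos c
     parts_sum := m.2.2 }, by
    refine mem_partitionsR3.2 ⟨fun p hp => ?_, by simpa using m.2.1⟩
    obtain ⟨c, _, rfl⟩ := Multiset.mem_map.1 hp
    exact IrrepClass.fst_mem_R3 c⟩

theorem nonempty_equiv_dimPartition_fiber {D N : ℕ} (P : partitionsR3 D N) :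
    Nonempty ({m : Multiset IrrepClass // m.map Sigma.fst = P.1.parts} ≃
      {m : {m : Multiset IrrepClass // m.card = N ∧ (m.map Sigma.fst).sum = D} //
        dimPartition m = P}) := by
  obtain ⟨P, hP⟩ := P
  have hN : P.parts.card = N := (mem_partitionsR3.1 hP).2
  exact ⟨{
    toFun := fun m => ⟨⟨m.1, by rw [← Multiset.card_map Sigma.fst, m.2, hN],
      by rw [m.2, P.parts_sum]⟩, Subtype.ext (Nat.Partition.ext m.2)⟩
    invFun := fun m => ⟨m.1.1, congrArg (fun P => P.1.parts) m.2⟩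
    left_inv := fun _ => rfl
    right_inv := fun _ => rfl }⟩

theorem mainTheorem2 (D N : ℕ) :
    (∀ d : ℕ, (irrepClasses d).Finite) ∧
    (preservingClasses D N).Finite ∧
    (preservingClasses D N).ncard =
      ∑ P ∈ partitionsR3 D N,
        ∏ p ∈ P.parts.toFinset,
          Nat.choose (P.parts.count p + xi p - 1) (P.parts.count p) := by
  have hfin (P : partitionsR3 D N) := finite_multiset_map_fst (J := fun d => irrepClasses d)
    P.1.parts
  -- Classes become multisets, and these are partitioned by their multiset of dimensions; the
  -- cardinality is then a sum over partitions.
  let e : preservingClasses D N ≃ Σ P : partitionsR3 D N,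
      {m : Multiset IrrepClass // m.map Sigma.fst = P.1.parts} :=
    (exists_equiv_preservingClasses D N).some.symm.trans ((Equiv.sigmaFiberEquiv _).symm.trans
      (Equiv.sigmaCongrRight fun P => (nonempty_equiv_dimPartition_fiber P).some.symm))
  refine ⟨irrepClasses_finite, ?_, ?_⟩
  · have := Finite.of_equiv _ e.symm
    exact Set.toFinite _
  · rw [← Nat.card_coe_set_eq, Nat.card_congr e, Nat.card_sigma,
      ← Finset.sum_coe_sort (partitionsR3 D N)]
    refine Finset.sum_congr rfl fun P _ => ?_
    refine (card_multiset_map_fst (J := fun d => irrepClasses d) P.1.parts).trans ?_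
    simp only [Nat.card_coe_set_eq, xi]
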